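/- Let $\mathcal{A}$ be a finite-dimensional unital $C^*$-algebra, let $\mathcal{K}$ be a finite-dimensional complex Hilbert space, and let $\varphi:\mathcal{A}\to\mathcal{B}(\mathcal{K})$ be a completely positive linear map (not necessarily unital). A (finite-dimensional) *purification* of $\varphi$ is a triple $(\mathcal{H},\pi,V)$ consisting of a finite-dimensional complex Hilbert space $\mathcal{H}$, a unital $^*$-homomorphism $\pi:\mathcal{A}\to\mathcal{B}(\mathcal{H})$, and a (bounded) linear map $V:\mathcal{K}\to\mathcal{H}$ such that $V^*\pi(a)V=\varphi(a)$ for all $a\in\mathcal{A}$. Then: 1. (Existence) $\varphi$ has a purification. 2. (Essential uniqueness) If $(\mathcal{H},\pi,V)$ and $(\mathcal{I},\rho,W)$ are two purifications of $\varphi$ for which the representations $(\mathcal{H},\pi)$ and $(\mathcal{I},\rho)$ are unitarily equivalent (that is, there is a unitary $U_0:\mathcal{H}\to\mathcal{I}$ with $U_0\pi(a)=\rho(a)U_0$ for all $a\in\mathcal{A}$), then there exists a unitary $U:\mathcal{H}\to\mathcal{I}$ such that $U\pi(a)=\rho(a)U$ for all $a\in\mathcal{A}$ and $UV=W$. -/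

import Mathlib

open scoped CStarAlgebra

universe u v w x

/-! Conventions. A (unital) C*-algebra is a `CStarAlgebra`; the order on it is the usual one, since
`StarOrderedRing` forces the nonnegative elements to be exactly the elements `star a * a`.
`B(K)` is `K →L[ℂ] K`, a representation is a unital *-homomorphism `A →⋆ₐ[ℂ] (H →L[ℂ] H)`, and an
operator-valued completely positive (OCP) map is a `φ : A →CP (K →L[ℂ] K)`, which is a linear map
all of whose ampliations to `n × n` matrices are positive; it is not assumed to be unital. -/

/-- `(H, π, V)` is a purification (Stinespring representation) of the OCP map `φ : A → B(K)`:
`V* π(a) V = φ(a)` for all `a`. The map `V` is bounded, but need not be an isometry, and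
the representation need not be minimal. -/
def IsPurification {A K H : Type*} [CStarAlgebra A] [PartialOrder A] [StarOrderedRing A]
    [NormedAddCommGroup K] [InnerProductSpace ℂ K] [CompleteSpace K]
    [NormedAddCommGroup H] [InnerProductSpace ℂ H] [CompleteSpace H]
    (φ : A →CP (K →L[ℂ] K)) (π : A →⋆ₐ[ℂ] (H →L[ℂ] H)) (V : K →L[ℂ] H) : Prop :=
  ∀ a : A, (ContinuousLinearMap.adjoint V) ∘L (π a) ∘L V = φ a

/-- The unitary `U : H → I` (a surjective linear isometry) intertwines the representations
`π` and `ρ`: `U π(a) = ρ(a) U` for all `a`. -/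
def IsUnitaryIntertwiner {A H I : Type*} [CStarAlgebra A]
    [NormedAddCommGroup H] [InnerProductSpace ℂ H] [CompleteSpace H]
    [NormedAddCommGroup I] [InnerProductSpace ℂ I] [CompleteSpace I]
    (π : A →⋆ₐ[ℂ] (H →L[ℂ] H)) (ρ : A →⋆ₐ[ℂ] (I →L[ℂ] I)) (U : H ≃ₗᵢ[ℂ] I) : Prop :=
  ∀ (a : A) (x : H), U (π a x) = ρ a (U x)

/-- The representations `(H, π)` and `(I, ρ)` are unitarily equivalent. -/
def UnitarilyEquivalent {A H I : Type*} [CStarAlgebra A]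
    [NormedAddCommGroup H] [InnerProductSpace ℂ H] [CompleteSpace H]
    [NormedAddCommGroup I] [InnerProductSpace ℂ I] [CompleteSpace I]
    (π : A →⋆ₐ[ℂ] (H →L[ℂ] H)) (ρ : A →⋆ₐ[ℂ] (I →L[ℂ] I)) : Prop :=
  ∃ U : H ≃ₗᵢ[ℂ] I, IsUnitaryIntertwiner π ρ U

/-!
Existence is Stinespring's construction. Complete positivity says exactly that the form
`⟨a ⊗ k, b ⊗ l⟩ = ⟨k, φ (a* b) l⟩` on `A ⊗ K` is positive semidefinite
(`stinespringForm_self_nonneg`). Left multiplication is compatible with this form, so it descends to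
a representation on the quotient by the null vectors, and `V k` is the class of `1 ⊗ k`
(`exists_isPurification`).

For uniqueness, the maps `a ⊗ k ↦ π a (V k)` and `a ⊗ k ↦ ρ a (W k)` both have the above form as
Gram form. Hence they differ by a partial isometry between their ranges, which is an intertwiner
`X : H → I` with `X V = W` and `X* W = V` (`IsPurification.exists_intertwines`). It has to be
extended to a unitary, although the orthogonal complements of the two ranges are not visibly
equivalent. Choose `X`, subject to these three properties, with a kernel of smallest dimension.
Then no intertwiner has a nonzero matrix entry from `ker X` to `ker X*`, since otherwise such a
corner could be added to `X` (`Intertwines.exists_finrank_ker_lt`). As `π` and `ρ` are equivalent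
and of finite dimension, this forces `ker X = 0`
(`Intertwines.injective_of_forall_inner_eq_zero`): this step replaces a decomposition into
irreducible representations. So `X` is invertible, and `X* X V = V`; therefore the
unitary part of the polar decomposition of `X` is an intertwiner that still sends `V k` to `W k`
(`exists_isUnitaryIntertwiner_of_bijective`).
-/

open ContinuousLinearMap
open scoped TensorProduct InnerProductSpace ComplexOrder

/-! ### Intertwining operators and cancellation -/

section Intertwiners

variable {A K H I : Type*} [CStarAlgebra A]
  [NormedAddCommGroup K] [InnerProductSpace ℂ K]
  [NormedAddCommGroup H] [InnerProductSpace ℂ H] [CompleteSpace H]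
  [NormedAddCommGroup I] [InnerProductSpace ℂ I] [CompleteSpace I]

/-- The bounded operator `X : H → I` intertwines the representations `π` and `ρ`; in contrast to
`IsUnitaryIntertwiner`, nothing is assumed about `X` beyond boundedness. -/
def Intertwines (π : A →⋆ₐ[ℂ] (H →L[ℂ] H)) (ρ : A →⋆ₐ[ℂ] (I →L[ℂ] I)) (X : H →L[ℂ] I) : Prop :=
  ∀ (a : A) (h : H), X (π a h) = ρ a (X h)

lemma inner_map_star_left (π : A →⋆ₐ[ℂ] (H →L[ℂ] H)) (a : A) (g h : H) :
    inner ℂ (π (star a) g) h = inner ℂ g (π a h) := by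
  rw [map_star, star_eq_adjoint, adjoint_inner_left]

lemma inner_map_star_right (π : A →⋆ₐ[ℂ] (H →L[ℂ] H)) (a : A) (g h : H) :
    inner ℂ g (π (star a) h) = inner ℂ (π a g) h := by
  rw [map_star, star_eq_adjoint, adjoint_inner_right]

namespace Intertwines

variable {π : A →⋆ₐ[ℂ] (H →L[ℂ] H)} {ρ : A →⋆ₐ[ℂ] (I →L[ℂ] I)} {X Y : H →L[ℂ] I}

lemma adjoint (hX : Intertwines π ρ X) : Intertwines ρ π (adjoint X) := fun a y => by
  refine ext_inner_left ℂ fun h => ?_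
  rw [adjoint_inner_right, ← inner_map_star_left, ← hX, ← inner_map_star_left,
    adjoint_inner_right]

lemma add (hX : Intertwines π ρ X) (hY : Intertwines π ρ Y) : Intertwines π ρ (X + Y) :=
  fun a h => by simp [hX a h, hY a h]

lemma comp {J : Type*} [NormedAddCommGroup J] [InnerProductSpace ℂ J] [CompleteSpace J]
    {τ : A →⋆ₐ[ℂ] (J →L[ℂ] J)} {Z : I →L[ℂ] J} (hZ : Intertwines ρ τ Z)
    (hX : Intertwines π ρ X) : Intertwines π τ (Z ∘L X) :=
  fun a h => by simp [hX a h, hZ a (X h)]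

end Intertwines

/-- The orthogonal projection onto an invariant subspace lies in the commutant, because the
orthogonal complement is invariant as well. -/
lemma intertwines_starProjection {π : A →⋆ₐ[ℂ] (H →L[ℂ] H)} (L : Submodule ℂ H)
    [L.HasOrthogonalProjection] (hL : ∀ (a : A), ∀ h ∈ L, π a h ∈ L) :
    Intertwines π π L.starProjection := fun a h => by
  refine Submodule.eq_starProjection_of_mem_of_inner_eq_zero
    (hL a _ (Submodule.starProjection_apply_mem L h)) fun g hg => ?_
  rw [← map_sub, ← inner_conj_symm, ← inner_map_star_left,
    Submodule.sub_starProjection_mem_orthogonal (K := L) h _ (hL _ g hg), map_zero]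

variable [FiniteDimensional ℂ H]

/-- Unitary part of the polar decomposition of an invertible intertwiner `X`: with
`S = (X* X)^(1/2)`, the operator `X S⁻¹` is a unitary intertwiner. It agrees with `X` on the fixed
vectors of `X* X`, as these are fixed by the positive operator `S` too. -/
lemma exists_isUnitaryIntertwiner_of_bijective {π : A →⋆ₐ[ℂ] (H →L[ℂ] H)}
    {ρ : A →⋆ₐ[ℂ] (I →L[ℂ] I)} {X : H →L[ℂ] I} (hX : Intertwines π ρ X)
    (hbij : Function.Bijective X) :
    ∃ U : H ≃ₗᵢ[ℂ] I, IsUnitaryIntertwiner π ρ U ∧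
      ∀ v : H, adjoint X (X v) = v → U v = X v := by
  set P : H →L[ℂ] H := adjoint X ∘L X with hP
  have hP0 : 0 ≤ P := by
    rw [nonneg_iff_isPositive]
    exact isPositive_adjoint_comp_self X
  set S : H →L[ℂ] H := CFC.sqrt P with hS
  have hSS : ∀ h, S (S h) = adjoint X (X h) := fun h => by
    have := CFC.sqrt_mul_sqrt_self P hP0
    exact congrArg (fun T : H →L[ℂ] H => T h) this
  have hSpos : S.IsPositive := by
    rw [← nonneg_iff_isPositive]
    exact CFC.sqrt_nonneg P
  have hcomm : Intertwines π π S := fun a h => by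
    have h1 : Commute P (π a) := by
      ext g
      exact (hX.adjoint.comp hX) a g
    have h2 : Commute S (π a) := h1.cfcₙ_nnreal _
    exact congrArg (fun T : H →L[ℂ] H => T h) h2.eq
  have hnorm : ∀ h, ‖X h‖ = ‖S h‖ := fun h => by
    have h1 : inner ℂ (X h) (X h) = inner ℂ (S h) (S h) := by
      rw [← adjoint_inner_right, ← hSS, ← adjoint_inner_left, hSpos.isSelfAdjoint.adjoint_eq]
    rw [inner_self_eq_norm_sq_to_K, inner_self_eq_norm_sq_to_K] at h1
    have h2 : ‖X h‖ ^ 2 = ‖S h‖ ^ 2 := by exact_mod_cast h1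
    exact (sq_eq_sq₀ (norm_nonneg _) (norm_nonneg _)).1 h2
  have hSinj : Function.Injective S := (injective_iff_map_eq_zero S).2 fun h hh => by
    have := hnorm h
    rw [hh, norm_zero, norm_eq_zero] at this
    exact (injective_iff_map_eq_zero X).1 hbij.1 h this
  let eS : H ≃ₗ[ℂ] H := LinearEquiv.ofInjectiveEndo (S : H →ₗ[ℂ] H) hSinj
  let eX : H ≃ₗ[ℂ] I := LinearEquiv.ofBijective (X : H →ₗ[ℂ] I) hbij
  let U : H ≃ₗᵢ[ℂ] I := ⟨eS.symm.trans eX, fun h => by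
    obtain ⟨g, rfl⟩ := eS.surjective h
    rw [LinearEquiv.trans_apply, LinearEquiv.symm_apply_apply]
    exact hnorm g⟩
  have hU : ∀ h, U (S h) = X h := fun h => by
    change eX (eS.symm (eS h)) = X h
    rw [LinearEquiv.symm_apply_apply]
    rfl
  refine ⟨U, fun a h => ?_, fun v hv => ?_⟩
  · obtain ⟨g, rfl⟩ := eS.surjective h
    change U (π a (S g)) = ρ a (U (S g))
    rw [← hcomm, hU, hU, hX]
  · -- `u = S v - v` satisfies `S u = -u`, so it vanishes by positivity of `S`.
    have hu : S (S v - v) = -(S v - v) := by rw [map_sub, hSS, hv]; abel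
    have h1 := hSpos.re_inner_nonneg_right (S v - v)
    rw [hu, inner_neg_right, map_neg, inner_self_eq_norm_sq] at h1
    have h2 : ‖S v - v‖ = 0 := by nlinarith [norm_nonneg (S v - v)]
    have h3 : S v = v := sub_eq_zero.1 (norm_eq_zero.1 h2)
    conv_lhs => rw [← h3]
    exact hU v

/-- If `π` and `ρ` are equivalent and no intertwiner has a nonzero matrix entry between `ker X` and
`ker X*`, then the intertwiner `X` is injective. This is the cancellation principle for
finite-dimensional representations: let `L` be the space of all `y` such that `U₀ S y ⟂ ker X*` for
all `S` in the commutant of `π`. It contains `ker X`, and `T = X* U₀` maps it injectively, hence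
onto, itself; but the range of `T` is orthogonal to `ker X`. -/
lemma Intertwines.injective_of_forall_inner_eq_zero {π : A →⋆ₐ[ℂ] (H →L[ℂ] H)}
    {ρ : A →⋆ₐ[ℂ] (I →L[ℂ] I)} {X : H →L[ℂ] I} (hX : Intertwines π ρ X)
    (U₀ : H ≃ₗᵢ[ℂ] I) (hU₀ : IsUnitaryIntertwiner π ρ U₀)
    (hZ : ∀ Z : H →L[ℂ] I, Intertwines π ρ Z → ∀ n : H, X n = 0 → ∀ r : I,
      ContinuousLinearMap.adjoint X r = 0 → inner ℂ r (Z n) = 0) :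
    Function.Injective X := by
  let U₁ : H →L[ℂ] I := (U₀ : H →L[ℂ] I)
  have hU₁ : Intertwines π ρ U₁ := hU₀
  let T : H →L[ℂ] H := ContinuousLinearMap.adjoint X ∘L U₁
  have hT : Intertwines π π T := hX.adjoint.comp hU₁
  let L : Submodule ℂ H :=
    { carrier := {y | ∀ S : H →L[ℂ] H, Intertwines π π S → ∀ r : I,
        ContinuousLinearMap.adjoint X r = 0 → inner ℂ r (U₁ (S y)) = 0}
      add_mem' := fun {y z} hy hz S hS r hr => by
        rw [map_add, map_add, inner_add_right, hy S hS r hr, hz S hS r hr, add_zero]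
      zero_mem' := fun S hS r hr => by simp
      smul_mem' := fun c y hy S hS r hr => by
        rw [map_smul, map_smul, inner_smul_right, hy S hS r hr, mul_zero] }
  have hTL : ∀ y ∈ L, (T : H →ₗ[ℂ] H) y ∈ L := fun y hy S hS r hr => hy (S ∘L T) (hS.comp hT) r hr
  have hinj : Function.Injective ((T : H →ₗ[ℂ] H).restrict hTL) := by
    refine (injective_iff_map_eq_zero _).2 fun y hy => ?_
    have h1 : ContinuousLinearMap.adjoint X (U₁ y) = 0 := congrArg Subtype.val hy
    have h2 := y.2 (ContinuousLinearMap.id ℂ H) (fun _ _ => rfl) (U₁ y) h1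
    have h3 : U₀ (y : H) = 0 := inner_self_eq_zero.1 h2
    exact Subtype.ext (U₀.map_eq_zero_iff.1 h3)
  have hsurj := LinearMap.injective_iff_surjective.1 hinj
  refine (injective_iff_map_eq_zero X).2 fun n hn => ?_
  obtain ⟨y, hy⟩ := hsurj ⟨n, fun S hS r hr => hZ _ (hU₁.comp hS) n hn r hr⟩
  have h1 : ContinuousLinearMap.adjoint X (U₁ y) = n := congrArg Subtype.val hy
  rw [← inner_self_eq_zero (𝕜 := ℂ)]
  conv_lhs => rw [← h1]
  rw [adjoint_inner_left, h1, hn, inner_zero_right]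

/-- An intertwiner `X` matching `V` and `W` whose kernel can be reached, through some intertwiner
`Z`, from the kernel of its adjoint is not of maximal rank: add to it the corner of `Z` between
these two kernels. The relations with `V` and `W` survive since these maps have ranges orthogonal
to the kernels. -/
lemma Intertwines.exists_finrank_ker_lt {π : A →⋆ₐ[ℂ] (H →L[ℂ] H)}
    {ρ : A →⋆ₐ[ℂ] (I →L[ℂ] I)} {V : K →L[ℂ] H} {W : K →L[ℂ] I} {X : H →L[ℂ] I}
    (hX : Intertwines π ρ X) (hV : ∀ k, X (V k) = W k)
    (hW : ∀ k, ContinuousLinearMap.adjoint X (W k) = V k)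
    {Z : H →L[ℂ] I} (hZ : Intertwines π ρ Z) {n : H} (hn : X n = 0) {r : I}
    (hr : ContinuousLinearMap.adjoint X r = 0) (hne : inner ℂ r (Z n) ≠ 0) :
    ∃ Y : H →L[ℂ] I, Intertwines π ρ Y ∧ (∀ k, Y (V k) = W k) ∧
      (∀ k, ContinuousLinearMap.adjoint Y (W k) = V k) ∧
      Module.finrank ℂ (LinearMap.ker (Y : H →ₗ[ℂ] I)) <
        Module.finrank ℂ (LinearMap.ker (X : H →ₗ[ℂ] I)) := by
  let N : Submodule ℂ H := LinearMap.ker (X : H →ₗ[ℂ] I)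
  let R : Submodule ℂ I := LinearMap.ker (ContinuousLinearMap.adjoint X : I →ₗ[ℂ] H)
  have memN : ∀ h, h ∈ N ↔ X h = 0 := fun h => Iff.rfl
  have memR : ∀ y, y ∈ R ↔ ContinuousLinearMap.adjoint X y = 0 := fun h => Iff.rfl
  have hPN : Intertwines π π N.starProjection := intertwines_starProjection N fun a h hh => by
    rw [memN] at hh ⊢
    rw [hX, hh, map_zero]
  have hPR : Intertwines ρ ρ R.starProjection := intertwines_starProjection R fun a h hh => by
    rw [memR] at hh ⊢
    rw [hX.adjoint, hh, map_zero]
  have hranX : ∀ h, X h ∈ Rᗮ := fun h y hy => by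
    rw [← adjoint_inner_left, (memR y).1 hy, inner_zero_left]
  have hVN : ∀ k, V k ∈ Nᗮ := fun k g hg => by
    rw [← hW, adjoint_inner_right, (memN g).1 hg, inner_zero_left]
  let C : H →L[ℂ] I := R.starProjection ∘L Z ∘L N.starProjection
  have hC : Intertwines π ρ C := hPR.comp (hZ.comp hPN)
  have hCR : ∀ h, C h ∈ R := fun h => Submodule.starProjection_apply_mem R _
  refine ⟨X + C, hX.add hC, fun k => ?_, fun k => ?_, ?_⟩
  · have : C (V k) = 0 := by
      simp only [C, ContinuousLinearMap.comp_apply]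
      rw [(Submodule.starProjection_apply_eq_zero_iff _).2 (hVN k), map_zero, map_zero]
    rw [add_apply, hV, this, add_zero]
  · have : ContinuousLinearMap.adjoint C (W k) = 0 := by
      refine ext_inner_left ℂ fun h => ?_
      rw [adjoint_inner_right, inner_zero_right, ← hV]
      exact hranX _ _ (hCR h)
    rw [map_add, add_apply, hW, this, add_zero]
  · have key : ∀ h, (X + C) h = 0 → X h = 0 ∧ C h = 0 := fun h hh => by
      rw [add_apply] at hh
      have h1 : X h = 0 := by
        have h2 : X h ∈ R := by
          rw [eq_neg_of_add_eq_zero_left hh]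
          exact R.neg_mem (hCR h)
        exact inner_self_eq_zero.1 (hranX h _ h2)
      rw [h1, zero_add] at hh
      exact ⟨h1, hh⟩
    refine Submodule.finrank_lt_finrank_of_lt (lt_of_le_of_ne (fun h hh => (key h hh).1) ?_)
    intro heq
    have h1 : n ∈ LinearMap.ker ((X + C : H →L[ℂ] I) : H →ₗ[ℂ] I) := heq ▸ hn
    have h2 : C n = 0 := (key n h1).2
    simp only [C, ContinuousLinearMap.comp_apply] at h2
    rw [Submodule.starProjection_eq_self_iff.2 ((memN n).2 hn),
      Submodule.starProjection_apply_eq_zero_iff] at h2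
    exact hne (h2 r hr)

variable [FiniteDimensional ℂ I]

/-- Start from one intertwiner matching `V` and `W` and pass to one of maximal rank: it is
invertible, and its unitary part still maps `V k` to `W k`. -/
lemma UnitarilyEquivalent.exists_isUnitaryIntertwiner_extend {π : A →⋆ₐ[ℂ] (H →L[ℂ] H)}
    {ρ : A →⋆ₐ[ℂ] (I →L[ℂ] I)} (hequiv : UnitarilyEquivalent π ρ) {V : K →L[ℂ] H}
    {W : K →L[ℂ] I} (hex : ∃ X : H →L[ℂ] I, Intertwines π ρ X ∧ (∀ k, X (V k) = W k) ∧
      ∀ k, adjoint X (W k) = V k) :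
    ∃ U : H ≃ₗᵢ[ℂ] I, IsUnitaryIntertwiner π ρ U ∧ ∀ k : K, U (V k) = W k := by
  obtain ⟨U₀, hU₀⟩ := hequiv
  obtain ⟨X, ⟨hX, hV, hW⟩, hmin⟩ := exists_minimalFor_of_wellFoundedLT
    (fun X : H →L[ℂ] I => Intertwines π ρ X ∧ (∀ k, X (V k) = W k) ∧
      ∀ k, adjoint X (W k) = V k)
    (fun X : H →L[ℂ] I => Module.finrank ℂ (LinearMap.ker (X : H →ₗ[ℂ] I))) hex
  have hinj : Function.Injective X := by
    refine hX.injective_of_forall_inner_eq_zero U₀ hU₀ fun Z hZ n hn r hr => ?_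
    by_contra hne
    obtain ⟨Y, hY, hYV, hYW, hlt⟩ := hX.exists_finrank_ker_lt hV hW hZ hn hr hne
    exact (hmin ⟨hY, hYV, hYW⟩ hlt.le).not_gt hlt
  have hsurj : Function.Surjective X :=
    (LinearMap.injective_iff_surjective_of_finrank_eq_finrank (f := (X : H →ₗ[ℂ] I))
      U₀.toLinearEquiv.finrank_eq).1 hinj
  obtain ⟨U, hU, hUX⟩ := exists_isUnitaryIntertwiner_of_bijective hX ⟨hinj, hsurj⟩
  exact ⟨U, hU, fun k => by rw [hUX _ (by rw [hV, hW]), hV]⟩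

end Intertwiners

lemma LinearMap.exists_comp_eq_of_ker_le {𝕜 E F G : Type*} [Field 𝕜] [AddCommGroup E] [Module 𝕜 E]
    [AddCommGroup F] [Module 𝕜 F] [AddCommGroup G] [Module 𝕜 G] (f : E →ₗ[𝕜] F) (g : E →ₗ[𝕜] G)
    (h : ∀ x, f x = 0 → g x = 0) : ∃ l : F →ₗ[𝕜] G, ∀ x, l (f x) = g x := by
  obtain ⟨s, hs⟩ := f.rangeRestrict.exists_rightInverse_of_surjective f.range_rangeRestrict
  obtain ⟨l, hl⟩ := (g ∘ₗ s).exists_extend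
  refine ⟨l, fun x => ?_⟩
  have h1 : l (f x) = g (s (f.rangeRestrict x)) := LinearMap.congr_fun hl (f.rangeRestrict x)
  rw [h1, ← sub_eq_zero, ← map_sub]
  refine h _ ?_
  have h2 := congrArg Subtype.val (LinearMap.congr_fun hs (f.rangeRestrict x))
  rw [map_sub, sub_eq_zero]
  exact h2

/-! ### Stinespring dilations -/

/-- Quotienting a finite-dimensional space by the null vectors of a positive semidefinite form gives
a Hilbert space. It is realized as a Euclidean space, in an arbitrary universe. -/
lemma exists_linearMap_inner_eq {E : Type*} [AddCommGroup E] [Module ℂ E] [FiniteDimensional ℂ E]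
    (c : PreInnerProductSpace.Core ℂ E) :
    ∃ (n : ℕ) (q : E →ₗ[ℂ] EuclideanSpace ℂ (ULift.{w} (Fin n))), Function.Surjective q ∧
      ∀ x y, inner ℂ (q x) (q y) = c.inner x y := by
  let : SeminormedAddCommGroup E := InnerProductSpace.Core.toSeminormedAddCommGroup (c := c)
  let : InnerProductSpace ℂ E := InnerProductSpace.ofCore c
  let p : E →ₗ[ℂ] SeparationQuotient E := (SeparationQuotient.mkCLM ℂ E).toLinearMap
  have hp : Function.Surjective p := SeparationQuotient.surjective_mk
  have : FiniteDimensional ℂ (SeparationQuotient E) := Module.Finite.of_surjective p hp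
  let e := ((stdOrthonormalBasis ℂ (SeparationQuotient E)).reindex
    (Equiv.ulift.{w}).symm).repr
  refine ⟨_, e.toLinearEquiv.toLinearMap ∘ₗ p, e.surjective.comp hp, fun x y => ?_⟩
  exact (e.inner_map_map (p x) (p y)).trans (SeparationQuotient.inner_mk_mk x y)

section OrbitMap

variable {A K H : Type*} [CStarAlgebra A] [NormedAddCommGroup K] [InnerProductSpace ℂ K]
  [NormedAddCommGroup H] [InnerProductSpace ℂ H] [CompleteSpace H]

/-- The map `A ⊗ K → H`, `a ⊗ k ↦ π a (V k)`, whose range is the subspace generated by `V` under the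
representation `π`. -/
noncomputable def orbitMap (π : A →⋆ₐ[ℂ] (H →L[ℂ] H)) (V : K →L[ℂ] H) : A ⊗[ℂ] K →ₗ[ℂ] H :=
  TensorProduct.lift <| LinearMap.mk₂ ℂ (fun a k => π a (V k))
    (fun a b k => by simp) (fun c a k => by simp) (fun a k l => by simp) (fun c a k => by simp)

lemma orbitMap_tmul (π : A →⋆ₐ[ℂ] (H →L[ℂ] H)) (V : K →L[ℂ] H) (a : A) (k : K) :
    orbitMap π V (a ⊗ₜ k) = π a (V k) := rfl

lemma orbitMap_mulLeft (π : A →⋆ₐ[ℂ] (H →L[ℂ] H)) (V : K →L[ℂ] H) (a : A) (t : A ⊗[ℂ] K) :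
    orbitMap π V ((LinearMap.mulLeft ℂ a).rTensor K t) = π a (orbitMap π V t) := by
  induction t using TensorProduct.induction_on with
  | zero => simp
  | add t t' ht ht' => simp only [map_add, ht, ht']
  | tmul b k => simp [orbitMap_tmul]

end OrbitMap

section Stinespring

variable {A : Type u} [CStarAlgebra A] [PartialOrder A] [StarOrderedRing A]
  {K : Type v} [NormedAddCommGroup K] [InnerProductSpace ℂ K] [CompleteSpace K]

/-- The entrywise positivity of the ampliations, in quadratic form. -/
lemma CompletelyPositiveMap.sum_inner_nonneg (φ : A →CP (K →L[ℂ] K)) {ι : Type*} [Fintype ι]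
    (a : ι → A) (k : ι → K) :
    0 ≤ ∑ i, ∑ j, inner ℂ (k i) (φ (star (a i) * a j) (k j)) := by
  classical
  rcases isEmpty_or_nonempty ι with h | ⟨⟨i₀⟩⟩
  · simp
  -- The matrix `(a i)* (a j)` is `R* R`, where the row `i₀` of `R` is `a` and the others vanish.
  let R : CStarMatrix ι ι A := CStarMatrix.ofMatrix fun i j => if i = i₀ then a j else 0
  have hR : ∀ i j, R i j = if i = i₀ then a j else 0 := fun i j => rfl
  have hpos := φ.map_cstarMatrix_nonneg (star R * R) (star_mul_self_nonneg R)
  have hentry : ∀ i j, φ (star (a i) * a j) = (star R * R).map φ i j := fun i j => by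
    simp [CStarMatrix.map_apply, CStarMatrix.mul_apply, CStarMatrix.star_apply, hR]
  simp only [hentry]
  generalize (star R * R).map φ = P at hpos
  rw [StarOrderedRing.nonneg_iff] at hpos
  induction hpos using AddSubmonoid.closure_induction with
  | mem P hP =>
    obtain ⟨B, rfl⟩ := hP
    have : ∑ i, ∑ j, inner ℂ (k i) ((star B * B) i j (k j)) =
        ∑ l, inner ℂ (∑ i, B l i (k i)) (∑ j, B l j (k j)) := by
      simp only [CStarMatrix.mul_apply, CStarMatrix.star_apply, sum_inner, inner_sum, sum_apply,
        star_eq_adjoint, mul_apply_eq_comp, adjoint_inner_right]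
      rw [Finset.sum_comm_cycle]
      exact Finset.sum_congr rfl fun l _ => Finset.sum_comm
    rw [this]
    exact Finset.sum_nonneg fun l _ => by
      rw [inner_self_eq_norm_sq_to_K]
      exact pow_nonneg (RCLike.ofReal_nonneg.2 (norm_nonneg _)) 2
  | zero => simp [CStarMatrix.zero_apply]
  | add P Q _ _ hP hQ =>
    simpa [CStarMatrix.add_apply, inner_add_right, Finset.sum_add_distrib] using add_nonneg hP hQ

/-- The sesquilinear form on `A ⊗ K` with `⟨a ⊗ k, b ⊗ l⟩ = ⟨k, φ (a* b) l⟩`, which is the Gram form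
of `a ⊗ k ↦ π a (V k)` for any purification `(H, π, V)` of `φ`. -/
noncomputable def stinespringForm (φ : A →CP (K →L[ℂ] K)) :
    A ⊗[ℂ] K →ₗ⋆[ℂ] A ⊗[ℂ] K →ₗ[ℂ] ℂ :=
  TensorProduct.lift <| LinearMap.mk₂'ₛₗ (starRingEnd ℂ) (starRingEnd ℂ)
    (fun a k => TensorProduct.lift <| LinearMap.mk₂ ℂ
      (fun b l => inner ℂ k (φ (star a * b) l))
      (fun b b' l => by simp [mul_add])
      (fun c b l => by simp)
      (fun b l l' => by simp)
      (fun c b l => by simp))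
    (fun a a' k => TensorProduct.ext' fun b l => by simp [add_mul])
    (fun c a k => TensorProduct.ext' fun b l => by simp)
    (fun a k k' => TensorProduct.ext' fun b l => by simp)
    (fun c a k => TensorProduct.ext' fun b l => by simp [mul_comm])

lemma stinespringForm_tmul (φ : A →CP (K →L[ℂ] K)) (a b : A) (k l : K) :
    stinespringForm φ (a ⊗ₜ k) (b ⊗ₜ l) = inner ℂ k (φ (star a * b) l) := by
  simp [stinespringForm]

lemma stinespringForm_self_nonneg (φ : A →CP (K →L[ℂ] K)) (t : A ⊗[ℂ] K) :
    0 ≤ stinespringForm φ t t := by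
  obtain ⟨S, rfl⟩ := TensorProduct.exists_finset t
  have h := φ.sum_inner_nonneg (fun i : S => i.1.1) (fun i : S => i.1.2)
  rw [Finset.sum_comm] at h
  rw [← Finset.sum_coe_sort S (fun i : A × K => i.1 ⊗ₜ[ℂ] i.2)]
  simpa [stinespringForm_tmul] using h

/-- Left multiplication on `A ⊗ K` is compatible with the involution. -/
lemma stinespringForm_mulLeft (φ : A →CP (K →L[ℂ] K)) (a : A) (s t : A ⊗[ℂ] K) :
    stinespringForm φ ((LinearMap.mulLeft ℂ (star a)).rTensor K s) t =
      stinespringForm φ s ((LinearMap.mulLeft ℂ a).rTensor K t) := by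
  induction s using TensorProduct.induction_on with
  | zero => simp
  | add s s' hs hs' => simp only [map_add, LinearMap.add_apply, hs, hs']
  | tmul b k =>
    induction t using TensorProduct.induction_on with
    | zero => simp
    | add t t' ht ht' => simp only [map_add, ht, ht']
    | tmul c l => simp [stinespringForm_tmul, mul_assoc]

/-- The Stinespring form as a semi-inner product; it is Hermitian because `φ`, being positive,
preserves the involution. -/
noncomputable abbrev stinespringCore (φ : A →CP (K →L[ℂ] K)) :
    PreInnerProductSpace.Core ℂ (A ⊗[ℂ] K) where
  inner s t := stinespringForm φ s t
  conj_inner_symm s t := by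
    induction s using TensorProduct.induction_on with
    | zero => simp
    | add s s' hs hs' => simp only [map_add, LinearMap.add_apply, hs, hs']
    | tmul b k =>
      induction t using TensorProduct.induction_on with
      | zero => simp
      | add t t' ht ht' => simp only [map_add, LinearMap.add_apply, ht, ht']
      | tmul c l =>
        have h : φ (star b * c) = adjoint (φ (star c * b)) := by
          rw [← star_eq_adjoint, ← map_star φ, star_mul, star_star]
        rw [stinespringForm_tmul, stinespringForm_tmul, inner_conj_symm, h, adjoint_inner_right]
  re_inner_nonneg t := (Complex.nonneg_iff.1 (stinespringForm_self_nonneg φ t)).1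
  add_left s t r := by simp
  smul_left s t r := by simp

variable {H : Type*} [NormedAddCommGroup H] [InnerProductSpace ℂ H] [CompleteSpace H]

lemma IsPurification.inner_orbitMap {φ : A →CP (K →L[ℂ] K)} {π : A →⋆ₐ[ℂ] (H →L[ℂ] H)}
    {V : K →L[ℂ] H} (h : IsPurification φ π V) (s t : A ⊗[ℂ] K) :
    inner ℂ (orbitMap π V s) (orbitMap π V t) = stinespringForm φ s t := by
  induction s using TensorProduct.induction_on with
  | zero => simp
  | add s s' hs hs' => simp only [map_add, LinearMap.add_apply, inner_add_left, hs, hs']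
  | tmul b k =>
    induction t using TensorProduct.induction_on with
    | zero => simp
    | add t t' ht ht' => simp only [map_add, inner_add_right, ht, ht']
    | tmul c l =>
      rw [stinespringForm_tmul, orbitMap_tmul, orbitMap_tmul, ← inner_map_star_right, ← h,
        ContinuousLinearMap.comp_apply, ContinuousLinearMap.comp_apply, adjoint_inner_right,
        map_mul, mul_apply_eq_comp]

/-- The operator which sends `π a (V k)` to `ρ a (W k)` and vanishes on the orthogonal complement
of these vectors intertwines the two representations. It is well defined because both orbit maps
have the same Gram form. -/
lemma IsPurification.exists_intertwines {I : Type*} [NormedAddCommGroup I] [InnerProductSpace ℂ I]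
    [CompleteSpace I] [FiniteDimensional ℂ H] {φ : A →CP (K →L[ℂ] K)}
    {π : A →⋆ₐ[ℂ] (H →L[ℂ] H)} {V : K →L[ℂ] H} {ρ : A →⋆ₐ[ℂ] (I →L[ℂ] I)} {W : K →L[ℂ] I}
    (hπ : IsPurification φ π V) (hρ : IsPurification φ ρ W) :
    ∃ X : H →L[ℂ] I, Intertwines π ρ X ∧ (∀ k, X (V k) = W k) ∧ ∀ k, adjoint X (W k) = V k := by
  obtain ⟨l, hl⟩ := (orbitMap π V).exists_comp_eq_of_ker_le (orbitMap ρ W) fun t ht => by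
    rw [← inner_self_eq_zero (𝕜 := ℂ), hρ.inner_orbitMap, ← hπ.inner_orbitMap, ht, inner_zero_left]
  let L : Submodule ℂ H := LinearMap.range (orbitMap π V)
  have hP : Intertwines π π L.starProjection := intertwines_starProjection L fun a h hh => by
    obtain ⟨t, rfl⟩ := hh
    exact ⟨_, orbitMap_mulLeft π V a t⟩
  have hl_apply : ∀ a, ∀ h ∈ L, l (π a h) = ρ a (l h) := fun a h hh => by
    obtain ⟨t, rfl⟩ := hh
    rw [← orbitMap_mulLeft, hl, hl, orbitMap_mulLeft]
  have hV_eq : ∀ k, V k = orbitMap π V (1 ⊗ₜ k) := fun k => by simp [orbitMap_tmul]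
  have hW_eq : ∀ k, W k = orbitMap ρ W (1 ⊗ₜ k) := fun k => by simp [orbitMap_tmul]
  have hVL : ∀ k, V k ∈ L := fun k => ⟨_, (hV_eq k).symm⟩
  refine ⟨LinearMap.toContinuousLinearMap l ∘L L.starProjection, fun a h => ?_, fun k => ?_,
    fun k => ?_⟩
  · simp only [ContinuousLinearMap.comp_apply, LinearMap.coe_toContinuousLinearMap']
    rw [hP, hl_apply _ _ (Submodule.starProjection_apply_mem L h)]
  · simp only [ContinuousLinearMap.comp_apply, LinearMap.coe_toContinuousLinearMap']
    rw [Submodule.starProjection_eq_self_iff.2 (hVL k), hV_eq, hl, hW_eq]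
  · refine ext_inner_right ℂ fun h => ?_
    rw [adjoint_inner_left]
    simp only [ContinuousLinearMap.comp_apply, LinearMap.coe_toContinuousLinearMap']
    obtain ⟨t, ht⟩ := Submodule.starProjection_apply_mem L h
    rw [← ht, hl, hW_eq, hρ.inner_orbitMap, ← hπ.inner_orbitMap, ← hV_eq, ht]
    exact L.inner_starProjection_left_eq_right (V k) h ▸
      (Submodule.starProjection_eq_self_iff.2 (hVL k)).symm ▸ rfl

/-- Stinespring dilation: left multiplication descends to the quotient of `A ⊗ K` by the null
vectors of the Stinespring form, and `V k` is the class of `1 ⊗ k`. -/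
lemma exists_isPurification [FiniteDimensional ℂ A] [FiniteDimensional ℂ K]
    (φ : A →CP (K →L[ℂ] K)) :
    ∃ (n : ℕ) (π : A →⋆ₐ[ℂ] (EuclideanSpace ℂ (ULift.{w} (Fin n)) →L[ℂ]
        EuclideanSpace ℂ (ULift.{w} (Fin n)))) (V : K →L[ℂ] EuclideanSpace ℂ (ULift.{w} (Fin n))),
      IsPurification φ π V := by
  obtain ⟨n, q, hq, hinner⟩ := exists_linearMap_inner_eq.{w} (stinespringCore φ)
  replace hinner : ∀ s t, inner ℂ (q s) (q t) = stinespringForm φ s t := hinner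
  let m : A → A ⊗[ℂ] K →ₗ[ℂ] A ⊗[ℂ] K := fun a => (LinearMap.mulLeft ℂ a).rTensor K
  have hstar : ∀ a s t, inner ℂ (q (m (star a) s)) (q t) = inner ℂ (q s) (q (m a t)) :=
    fun a s t => by rw [hinner, hinner, stinespringForm_mulLeft]
  have hm : ∀ a, ∃ T : EuclideanSpace ℂ (ULift.{w} (Fin n)) →ₗ[ℂ]
      EuclideanSpace ℂ (ULift.{w} (Fin n)), ∀ t, T (q t) = q (m a t) := fun a =>
    q.exists_comp_eq_of_ker_le (q ∘ₗ m a) fun t ht => by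
      rw [← inner_self_eq_zero (𝕜 := ℂ), LinearMap.comp_apply, ← hstar, ht, inner_zero_right]
  choose T hT using hm
  have hext : ∀ {S S' : EuclideanSpace ℂ (ULift.{w} (Fin n)) →L[ℂ]
      EuclideanSpace ℂ (ULift.{w} (Fin n))}, (∀ t, S (q t) = S' (q t)) → S = S' := fun h =>
    ContinuousLinearMap.ext fun y => by
      obtain ⟨t, rfl⟩ := hq y
      exact h t
  let P : A → EuclideanSpace ℂ (ULift.{w} (Fin n)) →L[ℂ] EuclideanSpace ℂ (ULift.{w} (Fin n)) :=
    fun a => LinearMap.toContinuousLinearMap (T a)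
  have hP : ∀ a t, P a (q t) = q (m a t) := hT
  have hone : P 1 = 1 := hext fun t => by simp [hP, m]
  have hadd : ∀ a b, P (a + b) = P a + P b := fun a b => hext fun t => by
    have : m (a + b) = m a + m b := TensorProduct.ext' fun c k => by
      simp [m, add_mul, TensorProduct.add_tmul]
    simp [hP, this]
  have hsmul : ∀ (c : ℂ) a, P (c • a) = c • P a := fun c a => hext fun t => by
    have : m (c • a) = c • m a := TensorProduct.ext' fun b k => by
      simp [m, TensorProduct.smul_tmul']
    simp [hP, this]
  have hmul : ∀ a b, P (a * b) = P a * P b := fun a b => hext fun t => by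
    have : m (a * b) = m a ∘ₗ m b := TensorProduct.ext' fun c k => by simp [m]
    simp [hP, this]
  have hadj : ∀ a, P (star a) = star (P a) := fun a => hext fun s => by
    refine ext_inner_right ℂ fun y => ?_
    obtain ⟨t, rfl⟩ := hq y
    rw [star_eq_adjoint, adjoint_inner_left, hP, hP, hstar]
  have hzero : P 0 = 0 := by simpa using hadd 0 0
  let π : A →⋆ₐ[ℂ] (EuclideanSpace ℂ (ULift.{w} (Fin n)) →L[ℂ]
      EuclideanSpace ℂ (ULift.{w} (Fin n))) :=
    { toFun := P
      map_one' := hone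
      map_mul' := hmul
      map_zero' := hzero
      map_add' := hadd
      commutes' := fun c => by
        rw [Algebra.algebraMap_eq_smul_one, hsmul, hone, ← Algebra.algebraMap_eq_smul_one]
      map_star' := hadj }
  let V : K →L[ℂ] EuclideanSpace ℂ (ULift.{w} (Fin n)) :=
    LinearMap.toContinuousLinearMap (q ∘ₗ TensorProduct.mk ℂ A K 1)
  have hV : ∀ k, V k = q (1 ⊗ₜ k) := fun k => rfl
  refine ⟨n, π, V, fun a => ContinuousLinearMap.ext fun k => ext_inner_left ℂ fun l => ?_⟩
  change inner ℂ l (adjoint V (P a (V k))) = _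
  rw [adjoint_inner_right, hV, hV, hP, hinner]
  simp [m, stinespringForm_tmul]

end Stinespring

/-- The purification postulate for OCP maps on finite-dimensional C*-algebras and
finite-dimensional Hilbert spaces: existence and essential uniqueness of purifications. -/
theorem corollary7p10
    {A : Type u} [CStarAlgebra A] [PartialOrder A] [StarOrderedRing A] [FiniteDimensional ℂ A]
    {K : Type v} [NormedAddCommGroup K] [InnerProductSpace ℂ K] [CompleteSpace K]
    [FiniteDimensional ℂ K]
    (φ : A →CP (K →L[ℂ] K)) :
    (∃ (H : Type w) (_ : NormedAddCommGroup H) (_ : InnerProductSpace ℂ H) (_ : CompleteSpace H)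
        (_ : FiniteDimensional ℂ H) (π : A →⋆ₐ[ℂ] (H →L[ℂ] H)) (V : K →L[ℂ] H),
        IsPurification φ π V) ∧
    (∀ (H : Type w) [NormedAddCommGroup H] [InnerProductSpace ℂ H] [CompleteSpace H]
        [FiniteDimensional ℂ H]
        (I : Type x) [NormedAddCommGroup I] [InnerProductSpace ℂ I] [CompleteSpace I]
        [FiniteDimensional ℂ I]
        (π : A →⋆ₐ[ℂ] (H →L[ℂ] H)) (V : K →L[ℂ] H)
        (ρ : A →⋆ₐ[ℂ] (I →L[ℂ] I)) (W : K →L[ℂ] I),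
        IsPurification φ π V → IsPurification φ ρ W → UnitarilyEquivalent π ρ →
        ∃ U : H ≃ₗᵢ[ℂ] I, IsUnitaryIntertwiner π ρ U ∧ ∀ k : K, U (V k) = W k) := by
  refine ⟨?_, ?_⟩
  · obtain ⟨n, π, V, h⟩ := exists_isPurification.{u, v, w} φ
    exact ⟨_, inferInstance, inferInstance, inferInstance, inferInstance, π, V, h⟩
  · intro H _ _ _ _ I _ _ _ _ π V ρ W hπ hρ hequiv
    exact hequiv.exists_isUnitaryIntertwiner_extend (hπ.exists_intertwines hρ)
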